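/- For a complex Banach space $X$ let $L(X)$ be the algebra of bounded linear operators on $X$ and $\sigma(\cdot)$ the spectrum. For $T\in L(X)$ write $(M,N)\in\mathrm{Red}(T)$ if $M,N$ are closed $T$-invariant subspaces with $X=M\oplus N$; $T_M$ denotes the restriction of $T$ to a $T$-invariant subspace $M$, and $T_{X/M}$ the operator induced by $T$ on $X/M$. $T$ is called almost invertible if there is $(M,N)\in\mathrm{Red}(T)$ such that $T_M$ is invertible in $L(M)$ and $\sigma(T_N)$ is at most countable; put $\sigma_{al}(T)=\{\lambda\in\mathbb C: T-\lambda I\text{ is not almost invertible}\}$. An operator is Browder if it is Fredholm with finite ascent and finite descent, $\sigma_b(R)=\{\lambda\in\mathbb{C}: R-\lambda I\text{ is not Browder}\}$, and $R\in L(X)$ is called Riesz if $\sigma_b(R)\subset\{0\}$. Let $X$ be a complex Banach space and $T\in L(X)$. Then: (i) $T$ is almost invertible if and only if its dual operator $T^*\in L(X^*)$, $T^*f=f\circ T$, is almost invertible. (ii) For every complex Banach space $Y$ and every $S\in L(Y)$, $T\oplus S\in L(X\oplus Y)$ is almost invertible if and only if both $T$ and $S$ are almost invertible. (iii) The following are equivalent: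 $T$ is almost invertible; $T^m$ is almost invertible for some integer $m\ge 1$; $T^m$ is almost invertible for every integer $m\ge 1$. (iv) If $M$ is a closed $T$-invariant subspace of $X$ such that both $T_M$ and $T_{X/M}$ are almost invertible, then $T$ is almost invertible. (v) If $R\in L(X)$ is a Riesz operator with $TR=RT$, then $\sigma_{al}(T+R)=\sigma_{al}(T)$. -/

import Mathlib

namespace AlmostInv

variable {X : Type*} [NormedAddCommGroup X] [NormedSpace ℂ X]

/-- `(M, N) ∈ Red(T)`: both `M` and `N` are closed `T`-invariant subspaces and `X = M ⊕ N`. -/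
structure Reduces (T : X →L[ℂ] X) (M N : Submodule ℂ X) : Prop where
  isClosed_left : IsClosed (M : Set X)
  isClosed_right : IsClosed (N : Set X)
  invariant_left : ∀ x ∈ M, T x ∈ M
  invariant_right : ∀ x ∈ N, T x ∈ N
  isCompl : IsCompl M N

/-- `T` is almost invertible: for some `(M, N) ∈ Red(T)` the restriction of `T` to `M` is
invertible and the restriction of `T` to `N` has at most countable spectrum. -/
def IsAlmostInvertible (T : X →L[ℂ] X) : Prop :=
  ∃ (M N : Submodule ℂ X) (h : Reduces T M N),
    IsUnit (T.restrict h.invariant_left : M →L[ℂ] M) ∧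
      (spectrum ℂ (T.restrict h.invariant_right : N →L[ℂ] N)).Countable

/-- The almost invertible spectrum `σ_al(T)`. -/
def almostSpectrum (T : X →L[ℂ] X) : Set ℂ :=
  {z | ¬ IsAlmostInvertible (T - z • (1 : X →L[ℂ] X))}

/-- A Browder operator: a Fredholm operator of finite ascent and finite descent. -/
structure IsBrowder (T : X →L[ℂ] X) : Prop where
  isFredholm : T.IsFredholm
  finite_ascent : ∃ n : ℕ, (T ^ n).ker = (T ^ (n + 1)).ker
  finite_descent : ∃ n : ℕ, (T ^ n).range = (T ^ (n + 1)).range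

/-- The Browder spectrum `σ_b(T)`. -/
def browderSpectrum (T : X →L[ℂ] X) : Set ℂ :=
  {z | ¬ IsBrowder (T - z • (1 : X →L[ℂ] X))}

/-- A Riesz operator: an operator whose Browder spectrum is contained in `{0}`. -/
def IsRiesz (R : X →L[ℂ] X) : Prop :=
  browderSpectrum R ⊆ {0}

/-- The dual operator `T* : X* → X*`, `T* f = f ∘ T`. -/
noncomputable def dualOp (T : X →L[ℂ] X) : StrongDual ℂ X →L[ℂ] StrongDual ℂ X :=
  ContinuousLinearMap.precomp ℂ T

/-- The operator `x + M ↦ T x + M` induced by `T` on `X ⧸ M`, for a `T`-invariant `M`. -/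
def quotientOp (T : X →L[ℂ] X) (M : Submodule ℂ X) (hM : ∀ x ∈ M, T x ∈ M) :
    (X ⧸ M) →L[ℂ] (X ⧸ M) :=
  M.liftQL (M.mkQL.comp T) fun x hx => by simpa using hM x hx

end AlmostInv

/-!
`T` is almost invertible if and only if `0` is not a condensation point of its spectrum, that is,
some disc around `0` meets `σ(T)` in a countable set. Indeed, such a disc contains a circle about
`0` that misses `σ(T)`, and the Riesz projection along this circle gives the required decomposition
of `X`. Parts (i)-(iv) thereby reduce to `σ(T*) = σ(T)`, `σ(T ⊕ S) = σ(T) ∪ σ(S)`, the spectral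
mapping theorem for powers, and `σ(T) ⊆ σ(T_M) ∪ σ(T_{X/M})`.

For (v), a commuting Riesz perturbation changes the spectrum by a countable set only. The Fitting
decompositions of the operators `R - z` with `z ≠ 0` provide projections `Q` of finite codimension,
commuting with everything that commutes with `R`, for which `R Q` has arbitrarily small spectral
radius. Along a sequence of such `Q` with the spectral radius tending to `0`, a point off `σ(T)` is
eventually off `σ(T + R Q)`, which differs from `σ(T + R)` by finitely many points.
-/

namespace AlmostInv

open Filter Metric Set Topology

section RieszProjection

open Real Complex

theorem map_circleIntegral {E F : Type*} [NormedAddCommGroup E] [NormedSpace ℂ E]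
    [CompleteSpace E] [NormedAddCommGroup F] [NormedSpace ℂ F] [CompleteSpace F] (L : E →L[ℂ] F)
    {f : ℂ → E} {c : ℂ} {r : ℝ} (hf : CircleIntegrable f c r) :
    L (∮ z in C(c, r), f z) = ∮ z in C(c, r), L (f z) := by
  simp only [circleIntegral, ← map_smul]
  exact (L.intervalIntegral_comp_comm hf.out).symm

theorem commute_resolvent {R A : Type*} [CommRing R] [Ring A] [Algebra R A] {a b : A} {z : R}
    (h : Commute b a) : Commute b (resolvent a z) := by
  by_cases hz : z ∈ resolventSet R a
  · rw [spectrum.resolvent_eq hz]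
    exact ((Algebra.commute_algebraMap_right z b).sub_right h).units_inv_right
      (u := hz.unit)
  · rw [resolvent, Ring.inverse_non_unit _ hz]
    exact Commute.zero_right b

variable {A : Type*} [NormedRing A] [NormedAlgebra ℂ A]

/-- The Riesz projection `(2πi)⁻¹ ∮ (z - a)⁻¹ dz` over the circle of centre `c` and radius `r`. It
is meaningful when the circle avoids the spectrum of `a`, and then splits off the part of the
spectrum inside the circle. -/
noncomputable def rieszProjection (a : A) (c : ℂ) (r : ℝ) : A :=
  (2 * π * I : ℂ)⁻¹ • ∮ z in C(c, r), resolvent a z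

/-- The Cauchy transform `(2πi)⁻¹ ∮ (z - w)⁻¹ (z - a)⁻¹ dz` of the resolvent over the circle of
centre `c` and radius `r`: up to sign, it inverts `w - a` on the complementary summand of the Riesz
projection for `w` inside the circle, and on its range for `w` outside. -/
noncomputable def resolventCauchyTransform (a : A) (c : ℂ) (r : ℝ) (w : ℂ) : A :=
  (2 * π * I : ℂ)⁻¹ • ∮ z in C(c, r), (z - w)⁻¹ • resolvent a z

variable [CompleteSpace A]

theorem commute_circleIntegral {f : ℂ → A} {b : A} {c : ℂ} {r : ℝ}
    (hf : CircleIntegrable f c r) (h : ∀ z, Commute b (f z)) :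
    Commute b (∮ z in C(c, r), f z) := by
  have hmul := map_circleIntegral (ContinuousLinearMap.mul ℂ A b) hf
  have hmul' := map_circleIntegral ((ContinuousLinearMap.mul ℂ A).flip b) hf
  simp only [ContinuousLinearMap.mul_apply', ContinuousLinearMap.flip_apply] at hmul hmul'
  rw [Commute, SemiconjBy, hmul, hmul']
  simp only [(h _).eq]

theorem continuousOn_resolvent (a : A) : ContinuousOn (resolvent a) (resolventSet ℂ a) :=
  fun _ hz => (spectrum.hasDerivAt_resolvent_const_left hz).continuousAt.continuousWithinAt

variable {a b : A} {c w : ℂ} {r : ℝ}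

theorem circleIntegrable_resolvent (hr : 0 ≤ r) (h : sphere c r ⊆ resolventSet ℂ a) :
    CircleIntegrable (resolvent a) c r :=
  ((continuousOn_resolvent a).mono h).circleIntegrable hr

theorem circleIntegrable_inv_smul_resolvent (hr : 0 ≤ r) (h : sphere c r ⊆ resolventSet ℂ a)
    (hw : w ∉ sphere c r) : CircleIntegrable (fun z => (z - w)⁻¹ • resolvent a z) c r := by
  have hinv : ContinuousOn (fun z => (z - w)⁻¹) (sphere c r) :=
    (continuous_sub_right w).continuousOn.inv₀ fun z hz hzw => hw (sub_eq_zero.1 hzw ▸ hz)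
  exact (hinv.smul ((continuousOn_resolvent a).mono h)).circleIntegrable hr

theorem commute_rieszProjection (hr : 0 ≤ r) (h : sphere c r ⊆ resolventSet ℂ a)
    (hb : Commute b a) : Commute b (rieszProjection a c r) :=
  (commute_circleIntegral (circleIntegrable_resolvent hr h)
    fun _ => commute_resolvent hb).smul_right _

theorem commute_resolventCauchyTransform (hr : 0 ≤ r) (h : sphere c r ⊆ resolventSet ℂ a)
    (hw : w ∉ sphere c r) (hb : Commute b a) : Commute b (resolventCauchyTransform a c r w) :=
  (commute_circleIntegral (circleIntegrable_inv_smul_resolvent hr h hw)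
    fun _ => (commute_resolvent hb).smul_right _).smul_right _

theorem sub_mul_resolventCauchyTransform (hr : 0 ≤ r) (h : sphere c r ⊆ resolventSet ℂ a)
    (hw : w ∉ sphere c r) :
    (algebraMap ℂ A w - a) * resolventCauchyTransform a c r w =
      ((2 * π * I : ℂ)⁻¹ * ∮ z in C(c, r), (z - w)⁻¹) • (1 : A) - rieszProjection a c r := by
  have hpoint : EqOn (fun z => (algebraMap ℂ A w - a) * ((z - w)⁻¹ • resolvent a z))
      (fun z => (z - w)⁻¹ • (1 : A) - resolvent a z) (sphere c r) := fun z hz => by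
    have hzw : z - w ≠ 0 := fun hzw => hw (sub_eq_zero.1 hzw ▸ hz)
    have hinv : (algebraMap ℂ A z - a) * resolvent a z = 1 := Ring.mul_inverse_cancel _ (h hz)
    have hsplit : algebraMap ℂ A w - a = (algebraMap ℂ A z - a) - (z - w) • (1 : A) := by
      rw [sub_smul, Algebra.algebraMap_eq_smul_one, Algebra.algebraMap_eq_smul_one]
      abel
    simp only [mul_smul_comm]
    rw [hsplit, sub_mul, hinv, smul_mul_assoc, one_mul, smul_sub, inv_smul_smul₀ hzw]
  have hint : CircleIntegrable (fun z => (z - w)⁻¹ • (1 : A)) c r :=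
    (circleIntegrable_sub_inv_iff.2 (.inr (by rwa [abs_of_nonneg hr]))).smul_continuousOn
      continuousOn_const
  have hmap := map_circleIntegral (ContinuousLinearMap.mul ℂ A (algebraMap ℂ A w - a))
    (circleIntegrable_inv_smul_resolvent hr h hw)
  simp only [ContinuousLinearMap.mul_apply'] at hmap
  rw [resolventCauchyTransform, rieszProjection, mul_smul_comm, hmap,
    circleIntegral.integral_congr hr hpoint,
    circleIntegral.integral_sub hint (circleIntegrable_resolvent hr h),
    circleIntegral.integral_smul_const, smul_sub, smul_smul]

theorem sub_mul_resolventCauchyTransform_of_mem_ball (h : sphere c r ⊆ resolventSet ℂ a)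
    (hw : w ∈ ball c r) :
    (algebraMap ℂ A w - a) * resolventCauchyTransform a c r w = 1 - rieszProjection a c r := by
  have hr : 0 ≤ r := dist_nonneg.trans (mem_ball.1 hw).le
  rw [sub_mul_resolventCauchyTransform hr h fun hw' => (mem_ball.1 hw).ne hw',
    circleIntegral.integral_sub_inv_of_mem_ball hw, inv_mul_cancel₀ two_pi_I_ne_zero, one_smul]

theorem sub_mul_resolventCauchyTransform_of_notMem_closedBall (hr : 0 ≤ r)
    (h : sphere c r ⊆ resolventSet ℂ a) (hw : w ∉ closedBall c r) :
    (algebraMap ℂ A w - a) * resolventCauchyTransform a c r w = -rieszProjection a c r := by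
  have hdiff : DifferentiableOn ℂ (fun z => (z - w)⁻¹) (closedBall c r) :=
    (differentiableOn_id.sub_const w).inv fun z hz hzw => hw (sub_eq_zero.1 hzw ▸ hz)
  rw [sub_mul_resolventCauchyTransform hr h fun hw' => hw (sphere_subset_closedBall hw'),
    (hdiff.diffContOnCl_ball subset_rfl).circleIntegral_eq_zero hr, mul_zero, zero_smul, zero_sub]

theorem rieszProjection_eq_of_annulus_subset {r₁ r₂ : ℝ} (hr₁ : 0 < r₁) (hr : r₁ ≤ r₂)
    (h : closedBall c r₂ \ ball c r₁ ⊆ resolventSet ℂ a) :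
    rieszProjection a c r₁ = rieszProjection a c r₂ := by
  have hd : ∀ z ∈ (ball c r₂ \ closedBall c r₁) \ ∅, DifferentiableAt ℂ (resolvent a) z :=
    fun z hz => (spectrum.hasDerivAt_resolvent_const_left
      (h ⟨ball_subset_closedBall hz.1.1, fun hz' => hz.1.2 (ball_subset_closedBall hz')⟩)
      ).differentiableAt
  rw [rieszProjection, rieszProjection,
    circleIntegral_eq_of_differentiable_on_annulus_off_countable hr₁ hr countable_empty
      ((continuousOn_resolvent a).mono h) hd]

theorem exists_gt_annulus_subset_resolventSet (h : sphere c r ⊆ resolventSet ℂ a) :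
    ∃ r' > r, closedBall c r' \ ball c r ⊆ resolventSet ℂ a := by
  have hclosed : IsClosed ((dist · c) '' spectrum ℂ a) :=
    ((spectrum.isCompact a).image (continuous_id.dist continuous_const)).isClosed
  have hr : r ∈ ((dist · c) '' spectrum ℂ a)ᶜ := by
    rintro ⟨z, hz, hzr⟩
    exact hz (h hzr)
  obtain ⟨ε, hε, hball⟩ := Metric.isOpen_iff.1 hclosed.isOpen_compl r hr
  refine ⟨r + ε / 2, by linarith, fun z hz => ?_⟩
  by_contra hzσ
  refine hball (a := dist z c) ?_ ⟨z, hzσ, rfl⟩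
  have hle : dist z c ≤ r + ε / 2 := hz.1
  have hge : r ≤ dist z c := not_lt.1 hz.2
  rw [mem_ball, Real.dist_eq, abs_lt]
  constructor <;> linarith

theorem circleIntegral_resolventCauchyTransform_eq_zero {r₁ r₂ : ℝ} (hr₁ : 0 ≤ r₁) (hr : r₁ < r₂)
    (h : sphere c r₂ ⊆ resolventSet ℂ a) :
    ∮ z in C(c, r₁), resolventCauchyTransform a c r₂ z = 0 := by
  lift r₂ to NNReal using hr₁.trans hr.le
  have hseries := hasFPowerSeriesOn_cauchy_integral
    (circleIntegrable_resolvent r₂.2 h) (hr₁.trans_lt hr)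
  have hdiff := hseries.differentiableOn
  rw [eball_coe] at hdiff
  exact ((hdiff.mono (closedBall_subset_ball hr)).diffContOnCl_ball
    subset_rfl).circleIntegral_eq_zero hr₁

theorem isIdempotentElem_rieszProjection (hr : 0 < r) (h : sphere c r ⊆ resolventSet ℂ a) :
    IsIdempotentElem (rieszProjection a c r) := by
  obtain ⟨r', hr', hannulus⟩ := exists_gt_annulus_subset_resolventSet h
  have hP := rieszProjection_eq_of_annulus_subset hr hr'.le hannulus
  have h' : sphere c r' ⊆ resolventSet ℂ a := fun z hz =>
    hannulus ⟨sphere_subset_closedBall hz, fun hz' =>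
      (mem_ball.1 hz').not_ge (mem_sphere.1 hz ▸ hr'.le)⟩
  have hpoint : EqOn (fun z => resolvent a z * (1 - rieszProjection a c r'))
      (resolventCauchyTransform a c r') (sphere c r) := fun z hz => by
    have hinv : resolvent a z * (algebraMap ℂ A z - a) = 1 := Ring.inverse_mul_cancel _ (h hz)
    beta_reduce
    rw [← sub_mul_resolventCauchyTransform_of_mem_ball h' (sphere_subset_ball hr' hz),
      ← mul_assoc, hinv, one_mul]
  have hmap := map_circleIntegral ((ContinuousLinearMap.mul ℂ A).flip (1 - rieszProjection a c r'))
    (circleIntegrable_resolvent hr.le h)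
  simp only [ContinuousLinearMap.flip_apply, ContinuousLinearMap.mul_apply'] at hmap
  have hzero : rieszProjection a c r * (1 - rieszProjection a c r') = 0 := by
    rw [rieszProjection, smul_mul_assoc, hmap, circleIntegral.integral_congr hr.le hpoint,
      circleIntegral_resolventCauchyTransform_eq_zero hr.le hr' h', smul_zero]
  rw [← hP, mul_sub, mul_one, sub_eq_zero] at hzero
  exact hzero.symm

end RieszProjection

section Operators

variable {X : Type*} [NormedAddCommGroup X] [NormedSpace ℂ X]
  {Y : Type*} [NormedAddCommGroup Y] [NormedSpace ℂ Y]

theorem algebraMap_sub_mem {T : X →L[ℂ] X} {M : Submodule ℂ X} (hM : ∀ x ∈ M, T x ∈ M) (z : ℂ) :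
    ∀ x ∈ M, (algebraMap ℂ (X →L[ℂ] X) z - T) x ∈ M :=
  fun x hx => M.sub_mem (M.smul_mem z hx) (hM x hx)

theorem algebraMap_sub_restrict {T : X →L[ℂ] X} {M : Submodule ℂ X} (hM : ∀ x ∈ M, T x ∈ M)
    (z : ℂ) :
    algebraMap ℂ (M →L[ℂ] M) z - T.restrict hM =
      (algebraMap ℂ (X →L[ℂ] X) z - T).restrict (algebraMap_sub_mem hM z) :=
  rfl

theorem algebraMap_sub_quotientOp {T : X →L[ℂ] X} {M : Submodule ℂ X} (hM : ∀ x ∈ M, T x ∈ M)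
    (z : ℂ) :
    algebraMap ℂ (X ⧸ M →L[ℂ] X ⧸ M) z - quotientOp T M hM =
      quotientOp (algebraMap ℂ (X →L[ℂ] X) z - T) M (algebraMap_sub_mem hM z) := by
  ext x
  obtain ⟨x, rfl⟩ := Submodule.Quotient.mk_surjective M x
  rfl

theorem isUnit_restrict_of_mul_eq {S T U : X →L[ℂ] X} {M : Submodule ℂ X}
    (hS : ∀ x ∈ M, S x ∈ M) (hT : ∀ x ∈ M, T x ∈ M) (hST : Commute S T) (hmul : S * T = U)
    (hU : ∀ x ∈ M, U x = x) : IsUnit (T.restrict hT : M →L[ℂ] M) := by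
  refine isUnit_iff_exists.2 ⟨S.restrict hS, ?_, ?_⟩ <;> ext x
  · change (T * S) x = x
    rw [← hST.eq, hmul, hU x x.2]
  · change (S * T) x = x
    rw [hmul, hU x x.2]

theorem Reduces.of_commute {T P : X →L[ℂ] X} (hP : IsIdempotentElem P) (hPT : Commute P T) :
    Reduces T P.ker P.range := by
  obtain ⟨hrange, hker⟩ := (ContinuousLinearMap.IsIdempotentElem.commute_iff hP).1 hPT
  have hcompl := ContinuousLinearMap.IsIdempotentElem.isTopCompl hP
  exact ⟨P.isClosed_ker, hcompl.isClosed, hker, hrange, hcompl.isCompl.symm⟩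

variable [CompleteSpace X] [CompleteSpace Y]

theorem isUnit_prodMap_iff {T : X →L[ℂ] X} {S : Y →L[ℂ] Y} :
    IsUnit (T.prodMap S) ↔ IsUnit T ∧ IsUnit S := by
  simp only [ContinuousLinearMap.isUnit_iff_bijective, ContinuousLinearMap.coe_prodMap',
    Prod.map_bijective]

theorem spectrum_prodMap (T : X →L[ℂ] X) (S : Y →L[ℂ] Y) :
    spectrum ℂ (T.prodMap S) = spectrum ℂ T ∪ spectrum ℂ S := by
  ext z
  have hsub : algebraMap ℂ (X × Y →L[ℂ] X × Y) z - T.prodMap S =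
      (algebraMap ℂ (X →L[ℂ] X) z - T).prodMap (algebraMap ℂ (Y →L[ℂ] Y) z - S) := rfl
  rw [mem_union, spectrum.mem_iff, spectrum.mem_iff, spectrum.mem_iff, hsub, isUnit_prodMap_iff,
    not_and_or]

theorem Reduces.spectrum_eq {T : X →L[ℂ] X} {M N : Submodule ℂ X} (h : Reduces T M N) :
    spectrum ℂ T = spectrum ℂ (T.restrict h.invariant_left : M →L[ℂ] M) ∪
      spectrum ℂ (T.restrict h.invariant_right : N →L[ℂ] N) := by
  have := h.isClosed_left.completeSpace_coe
  have := h.isClosed_right.completeSpace_coe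
  let e : (M × N) ≃L[ℂ] X := Submodule.prodEquivOfIsTopCompl M N
    (Submodule.IsCompl.isTopCompl_of_isClosed h.isCompl h.isClosed_left h.isClosed_right)
  have hT : T = e.conjContinuousAlgEquiv
      ((T.restrict h.invariant_left).prodMap (T.restrict h.invariant_right)) := by
    ext x
    obtain ⟨y, rfl⟩ := e.surjective x
    simp [e]
  rw [← spectrum_prodMap]
  conv_lhs => rw [hT]
  exact AlgEquiv.spectrum_eq e.conjContinuousAlgEquiv.toAlgEquiv _

theorem isUnit_of_isUnit_restrict_of_isUnit_quotientOp {T : X →L[ℂ] X} {M : Submodule ℂ X}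
    [hclosed : IsClosed (M : Set X)] {hM : ∀ x ∈ M, T x ∈ M}
    (hTM : IsUnit (T.restrict hM : M →L[ℂ] M)) (hTq : IsUnit (quotientOp T M hM)) : IsUnit T := by
  have := hclosed.completeSpace_coe
  rw [ContinuousLinearMap.isUnit_iff_bijective] at hTM hTq ⊢
  have hmk (x : X) : quotientOp T M hM (M.mkQ x) = M.mkQ (T x) := rfl
  constructor
  · refine (injective_iff_map_eq_zero T).2 fun x hx => ?_
    have hxM : x ∈ M := by
      rw [← Submodule.ker_mkQ M, LinearMap.mem_ker]
      exact (injective_iff_map_eq_zero _).1 hTq.1 _ (by rw [hmk, hx, map_zero])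
    exact congrArg Subtype.val ((injective_iff_map_eq_zero _).1 hTM.1 ⟨x, hxM⟩ (Subtype.ext hx))
  · intro y
    obtain ⟨q, hq⟩ := hTq.2 (M.mkQ y)
    obtain ⟨x, rfl⟩ := M.mkQ_surjective q
    have hsub : T x - y ∈ M := by
      rw [← Submodule.ker_mkQ M, LinearMap.mem_ker, map_sub, ← hmk, hq, sub_self]
    obtain ⟨m, hm⟩ := hTM.2 ⟨T x - y, hsub⟩
    have hTm : T m = T x - y := congrArg Subtype.val hm
    exact ⟨x - m, by rw [map_sub, hTm, sub_sub_cancel]⟩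

theorem spectrum_subset_union_quotientOp {T : X →L[ℂ] X} {M : Submodule ℂ X}
    [IsClosed (M : Set X)] (hM : ∀ x ∈ M, T x ∈ M) :
    spectrum ℂ T ⊆
      spectrum ℂ (T.restrict hM : M →L[ℂ] M) ∪ spectrum ℂ (quotientOp T M hM) := by
  refine fun z hz => or_iff_not_and_not.2 fun ⟨hzM, hzq⟩ => hz ?_
  rw [spectrum.notMem_iff, algebraMap_sub_restrict] at hzM
  rw [spectrum.notMem_iff, algebraMap_sub_quotientOp] at hzq
  exact isUnit_of_isUnit_restrict_of_isUnit_quotientOp hzM hzq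

end Operators

section Dual

variable {X : Type*} [NormedAddCommGroup X] [NormedSpace ℂ X]

theorem isUnit_dualOp {T : X →L[ℂ] X} (hT : IsUnit T) : IsUnit (dualOp T) := by
  obtain ⟨S, hTS, hST⟩ := isUnit_iff_exists.1 hT
  have hmul (A B : X →L[ℂ] X) : dualOp (A * B) = dualOp B * dualOp A := rfl
  have hone : dualOp (1 : X →L[ℂ] X) = 1 := rfl
  exact isUnit_iff_exists.2 ⟨dualOp S, by rw [← hmul, hST, hone], by rw [← hmul, hTS, hone]⟩

theorem exists_antilipschitzWith_of_isUnit_dualOp {T : X →L[ℂ] X} (hT : IsUnit (dualOp T)) :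
    ∃ K, AntilipschitzWith K T := by
  obtain ⟨V, -, hV⟩ := isUnit_iff_exists.1 (isUnit_dualOp hT)
  refine ⟨‖V‖₊, T.antilipschitz_of_bound fun x => ?_⟩
  let J := NormedSpace.inclusionInDoubleDualLi (𝕜 := ℂ) (E := X)
  calc ‖x‖ = ‖V (dualOp (dualOp T) (J x))‖ := by
        rw [← J.norm_map x]
        exact congrArg norm (DFunLike.congr_fun hV (J x)).symm
    _ ≤ ‖V‖ * ‖J (T x)‖ := V.le_opNorm _
    _ = ‖V‖ * ‖T x‖ := by rw [J.norm_map]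

theorem surjective_of_injective_dualOp {T : X →L[ℂ] X} (hclosed : IsClosed (T.range : Set X))
    (hinj : Function.Injective (dualOp T)) : Function.Surjective T := by
  by_contra hsurj
  obtain ⟨y, hy⟩ := not_forall.1 hsurj
  have hy0 : T.range.mkQ y ≠ 0 := fun h => hy ((Submodule.Quotient.mk_eq_zero _).1 h)
  obtain ⟨g, hg⟩ := SeparatingDual.exists_ne_zero (R := ℂ) hy0
  have hgT : dualOp T (g.comp T.range.mkQL) = 0 := by
    ext x
    have hx : T.range.mkQ (T x) = 0 := (Submodule.Quotient.mk_eq_zero _).2 ⟨x, rfl⟩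
    exact (congrArg g hx).trans (map_zero g)
  exact hg (DFunLike.congr_fun ((injective_iff_map_eq_zero _).1 hinj _ hgT) y)

variable [CompleteSpace X]

theorem isUnit_dualOp_iff {T : X →L[ℂ] X} : IsUnit (dualOp T) ↔ IsUnit T := by
  refine ⟨fun hT => ?_, isUnit_dualOp⟩
  obtain ⟨K, hK⟩ := exists_antilipschitzWith_of_isUnit_dualOp hT
  exact T.isUnit_iff_bijective.2 ⟨hK.injective, surjective_of_injective_dualOp
    (hK.isClosed_range T.uniformContinuous)
    ((dualOp T).isUnit_iff_bijective.1 hT).1⟩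

theorem spectrum_dualOp (T : X →L[ℂ] X) : spectrum ℂ (dualOp T) = spectrum ℂ T := by
  ext z
  have hsub : dualOp (z • (1 : X →L[ℂ] X) - T) =
      z • (1 : StrongDual ℂ X →L[ℂ] StrongDual ℂ X) - dualOp T := by
    ext f x
    change f (z • x - T x) = z • f x - f (T x)
    rw [map_sub, map_smul]
  rw [spectrum.mem_iff, spectrum.mem_iff, Algebra.algebraMap_eq_smul_one,
    Algebra.algebraMap_eq_smul_one, ← hsub, isUnit_dualOp_iff]

end Dual

section Characterization

variable {X : Type*} [NormedAddCommGroup X] [NormedSpace ℂ X] [CompleteSpace X]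

theorem disjoint_ball_spectrum_restrict_ker_rieszProjection {T : X →L[ℂ] X} {c : ℂ} {r : ℝ}
    (hr : 0 < r) (h : sphere c r ⊆ resolventSet ℂ T)
    (hT : ∀ x ∈ (rieszProjection T c r).ker, T x ∈ (rieszProjection T c r).ker) :
    Disjoint (ball c r) (spectrum ℂ (T.restrict hT)) := by
  refine disjoint_left.2 fun w hw => ?_
  have hw' : w ∉ sphere c r := fun hw' => (mem_ball.1 hw).ne hw'
  have hP := commute_rieszProjection hr.le h (Commute.refl T)
  have hPG := commute_resolventCauchyTransform hr.le h hw' hP.symm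
  have hGT := (Algebra.commute_algebraMap_right w _).sub_right
    (commute_resolventCauchyTransform hr.le h hw' (Commute.refl T)).symm
  have hred := Reduces.of_commute (isIdempotentElem_rieszProjection hr h) hPG
  rw [spectrum.notMem_iff, algebraMap_sub_restrict]
  refine isUnit_restrict_of_mul_eq hred.invariant_left _ hGT
    (hGT.eq.trans (sub_mul_resolventCauchyTransform_of_mem_ball h hw)) fun x hx => ?_
  rw [sub_apply, show rieszProjection T c r x = 0 from hx, sub_zero, one_apply_eq_self]

theorem spectrum_restrict_range_rieszProjection_subset_closedBall {T : X →L[ℂ] X} {c : ℂ} {r : ℝ}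
    (hr : 0 < r) (h : sphere c r ⊆ resolventSet ℂ T)
    (hT : ∀ x ∈ (rieszProjection T c r).range, T x ∈ (rieszProjection T c r).range) :
    spectrum ℂ (T.restrict hT) ⊆ closedBall c r := by
  refine fun w hwσ => by_contra fun hw => hwσ ?_
  have hw' : w ∉ sphere c r := fun hw' => hw (sphere_subset_closedBall hw')
  have hidem := isIdempotentElem_rieszProjection hr h
  have hP := commute_rieszProjection hr.le h (Commute.refl T)
  have hPG := commute_resolventCauchyTransform hr.le h hw' hP.symm
  have hGT := (Algebra.commute_algebraMap_right w _).sub_right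
    (commute_resolventCauchyTransform hr.le h hw' (Commute.refl T)).symm
  have hred := Reduces.of_commute hidem hPG.neg_right
  rw [spectrum.mem_resolventSet_iff, algebraMap_sub_restrict]
  refine isUnit_restrict_of_mul_eq hred.invariant_right _ hGT.neg_left (U := rieszProjection T c r)
    ?_ ?_
  · rw [neg_mul, hGT.eq, sub_mul_resolventCauchyTransform_of_notMem_closedBall hr.le h hw, neg_neg]
  · rintro _ ⟨x, rfl⟩
    exact DFunLike.congr_fun hidem.eq x

theorem exists_disjoint_sphere_of_countable_inter_ball {E : Type*} [PseudoMetricSpace E]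
    {s : Set E} {c : E} {r : ℝ} (hr : 0 < r) (hs : (s ∩ ball c r).Countable) :
    ∃ ρ ∈ Ioo 0 r, Disjoint (sphere c ρ) s := by
  obtain ⟨ρ, hρs, hρ⟩ := ((hs.image (dist · c)).dense_compl ℝ).exists_between hr
  refine ⟨ρ, hρ, disjoint_left.2 fun z hz hzs => hρs ⟨z, ⟨hzs, ?_⟩, hz⟩⟩
  exact mem_ball.2 (mem_sphere.1 hz ▸ hρ.2)

theorem isAlmostInvertible_of_countable_spectrum_inter_ball {T : X →L[ℂ] X} {r : ℝ} (hr : 0 < r)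
    (h : (spectrum ℂ T ∩ ball 0 r).Countable) : IsAlmostInvertible T := by
  obtain ⟨ρ, ⟨hρ, hρr⟩, hdisj⟩ := exists_disjoint_sphere_of_countable_inter_ball hr h
  have hsphere : sphere 0 ρ ⊆ resolventSet ℂ T := fun z hz => not_not.1 (disjoint_left.1 hdisj hz)
  have hred := Reduces.of_commute (isIdempotentElem_rieszProjection hρ hsphere)
    (commute_rieszProjection hρ.le hsphere (Commute.refl T)).symm
  refine ⟨_, _, hred, ?_, h.mono (subset_inter ?_ ?_)⟩
  · rw [← spectrum.zero_notMem_iff ℂ]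
    exact disjoint_left.1 (disjoint_ball_spectrum_restrict_ker_rieszProjection hρ hsphere _)
      (mem_ball_self hρ)
  · exact hred.spectrum_eq ▸ subset_union_right
  · exact (spectrum_restrict_range_rieszProjection_subset_closedBall hρ hsphere _).trans
      (closedBall_subset_ball hρr)

theorem eventually_inf_cocountable_notMem_iff {E : Type*} [PseudoMetricSpace E] {s : Set E}
    {c : E} :
    (∀ᶠ z in 𝓝 c ⊓ cocountable, z ∉ s) ↔ ∃ r > 0, (s ∩ ball c r).Countable := by
  rw [eventually_iff, (nhds_basis_ball.inf (basis_sets cocountable)).mem_iff]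
  constructor
  · rintro ⟨⟨r, t⟩, ⟨hr, ht⟩, hst⟩
    exact ⟨r, hr, (mem_cocountable.1 ht).mono fun z hz hzt => hst ⟨hz.2, hzt⟩ hz.1⟩
  · rintro ⟨r, hr, hs⟩
    exact ⟨(r, (s ∩ ball c r)ᶜ), ⟨hr, mem_cocountable.2 (by rwa [compl_compl])⟩,
      fun z hz hzs => hz.2 ⟨hzs, hz.1⟩⟩

theorem eventually_notMem_spectrum {A : Type*} [NormedRing A] [NormedAlgebra ℂ A]
    [CompleteSpace A] {a : A} {w : ℂ} (hw : w ∉ spectrum ℂ a) : ∀ᶠ z in 𝓝 w, z ∉ spectrum ℂ a :=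
  (spectrum.isClosed a).isOpen_compl.eventually_mem hw

theorem isAlmostInvertible_iff {T : X →L[ℂ] X} :
    IsAlmostInvertible T ↔ ∀ᶠ z in 𝓝 (0 : ℂ) ⊓ cocountable, z ∉ spectrum ℂ T := by
  refine ⟨fun ⟨M, N, h, hM, hN⟩ => ?_, fun h => ?_⟩
  · have := h.isClosed_left.completeSpace_coe
    have hnear : ∀ᶠ z in 𝓝 0, z ∉ spectrum ℂ (T.restrict h.invariant_left : M →L[ℂ] M) :=
      eventually_notMem_spectrum (A := M →L[ℂ] M) ((spectrum.zero_notMem_iff ℂ).2 hM)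
    have hmost : ∀ᶠ z in cocountable, z ∉ spectrum ℂ (T.restrict h.invariant_right : N →L[ℂ] N) :=
      mem_cocountable.2 (by rwa [← compl_def, compl_compl])
    filter_upwards [hnear.filter_mono inf_le_left, hmost.filter_mono inf_le_right] with z hzM hzN
    rw [h.spectrum_eq]
    exact not_or_intro hzM hzN
  · obtain ⟨r, hr, hc⟩ := eventually_inf_cocountable_notMem_iff.1 h
    exact isAlmostInvertible_of_countable_spectrum_inter_ball hr hc

theorem isAlmostInvertible_dualOp_iff {T : X →L[ℂ] X} :
    IsAlmostInvertible (dualOp T) ↔ IsAlmostInvertible T := by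
  rw [isAlmostInvertible_iff, isAlmostInvertible_iff, spectrum_dualOp]

theorem isAlmostInvertible_prodMap_iff {Y : Type*} [NormedAddCommGroup Y] [NormedSpace ℂ Y]
    [CompleteSpace Y] {T : X →L[ℂ] X} {S : Y →L[ℂ] Y} :
    IsAlmostInvertible (T.prodMap S) ↔ IsAlmostInvertible T ∧ IsAlmostInvertible S := by
  simp only [isAlmostInvertible_iff, spectrum_prodMap, mem_union, not_or, eventually_and]

theorem tendsto_pow_nhds_zero_inf_cocountable {m : ℕ} (hm : 1 ≤ m) :
    Tendsto (fun z : ℂ => z ^ m) (𝓝 0 ⊓ cocountable) (𝓝 0 ⊓ cocountable) := by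
  refine Tendsto.inf ?_ fun s hs => ?_
  · simpa [zero_pow (by omega : m ≠ 0)] using (continuous_pow m).tendsto (0 : ℂ)
  · rw [mem_map, mem_cocountable, ← preimage_compl, ← biUnion_preimage_singleton]
    refine (mem_cocountable.1 hs).biUnion fun w _ => Finite.countable ?_
    refine (Polynomial.nthRoots m w).toFinset.finite_toSet.subset fun z hz => ?_
    simpa [Polynomial.mem_nthRoots hm] using hz

theorem isAlmostInvertible_pow_iff {T : X →L[ℂ] X} {m : ℕ} (hm : 1 ≤ m) :
    IsAlmostInvertible (T ^ m) ↔ IsAlmostInvertible T := by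
  rw [isAlmostInvertible_iff, isAlmostInvertible_iff]
  refine ⟨fun h => ?_, fun h => ?_⟩
  · filter_upwards [tendsto_pow_nhds_zero_inf_cocountable hm h] with z hz hzT
    exact hz (spectrum.pow_mem_pow T m hzT)
  · rw [eventually_inf_cocountable_notMem_iff] at h ⊢
    obtain ⟨r, hr, hcount⟩ := h
    refine ⟨r ^ m, pow_pos hr m, (hcount.image (· ^ m)).mono ?_⟩
    rw [spectrum.map_pow_of_pos T hm]
    rintro _ ⟨⟨z, hz, rfl⟩, hzr⟩
    rw [mem_ball_zero_iff, norm_pow] at hzr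
    exact ⟨z, ⟨hz, mem_ball_zero_iff.2 (lt_of_pow_lt_pow_left₀ m hr.le hzr)⟩, rfl⟩

theorem isAlmostInvertible_of_restrict_of_quotientOp {T : X →L[ℂ] X} {M : Submodule ℂ X}
    [hclosed : IsClosed (M : Set X)] {hM : ∀ x ∈ M, T x ∈ M}
    (hTM : IsAlmostInvertible (T.restrict hM : M →L[ℂ] M))
    (hTq : IsAlmostInvertible (quotientOp T M hM)) : IsAlmostInvertible T := by
  have := hclosed.completeSpace_coe
  rw [isAlmostInvertible_iff] at hTM hTq ⊢
  filter_upwards [hTM, hTq] with z hzM hzq hz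
  exact (spectrum_subset_union_quotientOp hM hz).elim hzM hzq

end Characterization

section SpectralRadius

open spectrum

theorem spectralRadius_neg {𝕜 A : Type*} [NormedField 𝕜] [Ring A] [Algebra 𝕜 A] (a : A) :
    spectralRadius 𝕜 (-a) = spectralRadius 𝕜 a := by
  rw [spectralRadius, ← spectrum.neg_eq, ← image_neg_eq_neg, iSup_image]
  simp only [nnnorm_neg, spectralRadius]

variable {A : Type*} [NormedRing A] [NormedAlgebra ℂ A] [CompleteSpace A]

theorem spectralRadius_lt_top (a : A) : spectralRadius ℂ a < ⊤ :=
  (spectralRadius_le_pow_nnnorm_pow_one_div ℂ a 0).trans_lt (by finiteness)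

theorem spectralRadius_mul_le {a b : A} (h : Commute a b) :
    spectralRadius ℂ (a * b) ≤ spectralRadius ℂ a * spectralRadius ℂ b := by
  refine le_of_tendsto_of_tendsto' (pow_nnnorm_pow_one_div_tendsto_nhds_spectralRadius (a * b))
    (ENNReal.Tendsto.mul (pow_nnnorm_pow_one_div_tendsto_nhds_spectralRadius a)
      (.inr (spectralRadius_lt_top b).ne) (pow_nnnorm_pow_one_div_tendsto_nhds_spectralRadius b)
      (.inr (spectralRadius_lt_top a).ne)) fun n => ?_
  rw [← ENNReal.mul_rpow_of_nonneg _ _ (by positivity), h.mul_pow]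
  gcongr
  exact_mod_cast nnnorm_mul_le (a ^ n) (b ^ n)

theorem isUnit_add_of_spectralRadius_inv_mul_lt_one {u : Aˣ} {b : A} (h : Commute (u : A) b)
    (hlt : spectralRadius ℂ (↑u⁻¹ : A) * spectralRadius ℂ b < 1) : IsUnit (u + b) := by
  have hmem : (-1 : ℂ) ∈ resolventSet ℂ (↑u⁻¹ * b) :=
    mem_resolventSet_of_spectralRadius_lt <|
      ((spectralRadius_mul_le h.units_inv_left).trans_lt hlt).trans_eq (by simp)
  have hfactor : (u : A) + b = -(u * (algebraMap ℂ A (-1) - ↑u⁻¹ * b)) := by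
    rw [map_neg, map_one, mul_sub, u.mul_inv_cancel_left, mul_neg_one, neg_sub, sub_neg_eq_add,
      add_comm]
  rw [hfactor]
  exact (u.isUnit.mul hmem).neg

end SpectralRadius

section Idempotent

variable {A : Type*} [Ring A] {p : A}

theorem mul_add_mul_one_sub_mul {a b c d : A} (hp : IsIdempotentElem p) (hc : Commute c p)
    (hd : Commute d p) :
    (a * p + b * (1 - p)) * (c * p + d * (1 - p)) = a * c * p + b * d * (1 - p) := by
  have hpc : p * (c * p) = c * p := by rw [← mul_assoc, ← hc.eq, mul_assoc, hp.eq]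
  have hpd : p * (d * (1 - p)) = 0 := by rw [← mul_assoc, ← hd.eq, mul_assoc, hp.mul_one_sub_self,
    mul_zero]
  simp only [add_mul, mul_add, mul_assoc, sub_mul 1 p, one_mul, hpc, hpd, sub_self, sub_zero,
    mul_zero, add_zero, zero_add]

theorem isUnit_mul_add_mul_one_sub {a b : A} (hp : IsIdempotentElem p) (ha : IsUnit a)
    (hb : IsUnit b) (hap : Commute a p) (hbp : Commute b p) :
    IsUnit (a * p + b * (1 - p)) := by
  lift a to Aˣ using ha
  lift b to Aˣ using hb
  refine isUnit_iff_exists.2 ⟨↑a⁻¹ * p + ↑b⁻¹ * (1 - p), ?_, ?_⟩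
  · rw [mul_add_mul_one_sub_mul hp hap.units_inv_left hbp.units_inv_left, a.mul_inv, b.mul_inv,
      one_mul, one_mul, add_sub_cancel]
  · rw [mul_add_mul_one_sub_mul hp hap hbp, a.inv_mul, b.inv_mul, one_mul, one_mul,
      add_sub_cancel]

theorem mul_add_one_sub_pow {a : A} (hp : IsIdempotentElem p) (ha : Commute a p) (n : ℕ) :
    (a * p + (1 - p)) ^ n = a ^ n * p + (1 - p) := by
  induction n with
  | zero => rw [pow_zero, pow_zero, one_mul, add_sub_cancel]
  | succ n ih =>
    have hmul := mul_add_mul_one_sub_mul (a := a ^ n) (b := 1) hp ha (Commute.one_left p)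
    rw [pow_succ, ih, pow_succ]
    simpa only [one_mul] using hmul

variable {𝕜 : Type*} [Field 𝕜] [Algebra 𝕜 A] {a : A} {z : 𝕜}

theorem notMem_spectrum_mul_of_isUnit (hp : IsIdempotentElem p) (hap : Commute a p) (hz : z ≠ 0)
    (h : IsUnit ((a - z • 1) * p + (1 - p))) : z ∉ spectrum 𝕜 (a * p) := by
  have hcomm : Commute ((a - z • 1) * p + (1 - p)) p :=
    ((hap.sub_left ((Commute.one_left p).smul_left z)).mul_left (Commute.refl p)).add_left
      ((Commute.one_left p).sub_left (Commute.refl p))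
  have hunit := isUnit_mul_add_mul_one_sub hp h ((IsUnit.mk0 (-z) (neg_ne_zero.2 hz)).map
    (algebraMap 𝕜 A)) hcomm (Algebra.commute_algebraMap_left _ p)
  rw [spectrum.notMem_iff, IsUnit.sub_iff]
  convert hunit using 1
  rw [add_mul, mul_assoc, hp.eq, hp.one_sub_mul_self, Algebra.algebraMap_eq_smul_one,
    Algebra.algebraMap_eq_smul_one]
  simp only [sub_mul, smul_mul_assoc, one_mul, neg_smul, neg_mul, smul_sub]
  abel

theorem spectrum_mul_subset_insert_zero (hp : IsIdempotentElem p) (hap : Commute a p) :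
    spectrum 𝕜 (a * p) ⊆ insert 0 (spectrum 𝕜 a) := by
  refine fun z hz => or_iff_not_imp_left.2 fun hz0 hza => ?_
  refine notMem_spectrum_mul_of_isUnit hp hap hz0 ?_ hz
  rw [← one_mul (1 - p), ← Algebra.algebraMap_eq_smul_one]
  exact isUnit_mul_add_mul_one_sub hp (IsUnit.sub_iff.1 hza) isUnit_one
    (hap.sub_left (Algebra.commute_algebraMap_left z p)) (Commute.one_left p)

end Idempotent

section Fitting

section Semiring

variable {R M : Type*} [Semiring R] [AddCommMonoid M] [Module R M] {f : Module.End R M}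

theorem ker_pow_add_of_ker_pow_eq_ker_pow_succ {n : ℕ} (h : (f ^ n).ker = (f ^ (n + 1)).ker)
    (k : ℕ) : (f ^ (n + k)).ker = (f ^ n).ker := by
  induction k with
  | zero => rfl
  | succ k ih =>
    rw [← add_assoc, pow_succ, Module.End.mul_eq_comp, LinearMap.ker_comp, ih,
      ← LinearMap.ker_comp, ← Module.End.mul_eq_comp, ← pow_succ, h]

theorem range_pow_add_of_range_pow_eq_range_pow_succ {n : ℕ}
    (h : (f ^ n).range = (f ^ (n + 1)).range) (k : ℕ) : (f ^ (n + k)).range = (f ^ n).range := by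
  induction k with
  | zero => rfl
  | succ k ih =>
    rw [← add_assoc, pow_succ', Module.End.mul_eq_comp, LinearMap.range_comp, ih,
      ← LinearMap.range_comp, ← Module.End.mul_eq_comp, ← pow_succ', h]

end Semiring

variable {R M : Type*} [Ring R] [AddCommGroup M] [Module R M] {f : Module.End R M}

theorem isCompl_range_ker_of_ker_mul_self_of_range_mul_self (hker : (f * f).ker = f.ker)
    (hrange : (f * f).range = f.range) : IsCompl f.range f.ker := by
  constructor
  · rw [Submodule.disjoint_def]
    rintro _ ⟨x, rfl⟩ hx
    exact hker.le hx
  · refine Submodule.codisjoint_iff_exists_add_eq.2 fun x => ?_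
    obtain ⟨y, hy⟩ := hrange.ge ⟨x, rfl⟩
    refine ⟨f y, x - f y, ⟨y, rfl⟩, ?_, add_sub_cancel _ _⟩
    rw [LinearMap.mem_ker, map_sub, sub_eq_zero]
    exact hy.symm

theorem exists_isCompl_range_pow_ker_pow (hker : ∃ n : ℕ, (f ^ n).ker = (f ^ (n + 1)).ker)
    (hrange : ∃ n : ℕ, (f ^ n).range = (f ^ (n + 1)).range) :
    ∃ p ≠ 0, IsCompl (f ^ p).range (f ^ p).ker := by
  obtain ⟨m, hm⟩ := hker
  obtain ⟨n, hn⟩ := hrange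
  refine ⟨m + n + 1, by omega, isCompl_range_ker_of_ker_mul_self_of_range_mul_self ?_ ?_⟩
  · rw [← pow_add, show m + n + 1 + (m + n + 1) = m + (n + 1 + (m + n + 1)) by ring, add_assoc m,
      ker_pow_add_of_ker_pow_eq_ker_pow_succ hm, ker_pow_add_of_ker_pow_eq_ker_pow_succ hm]
  · rw [← pow_add, show m + n + 1 = n + (m + 1) by ring, add_assoc n,
      range_pow_add_of_range_pow_eq_range_pow_succ hn,
      range_pow_add_of_range_pow_eq_range_pow_succ hn]

end Fitting

section Riesz

variable {X : Type*} [NormedAddCommGroup X] [NormedSpace ℂ X]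

/-- An idempotent `Q` with finite-dimensional kernel that commutes with every operator commuting
with `R`. For a Riesz operator `R` such projections discard the parts of the spectrum away from
`0`. -/
structure IsFiniteCodimProjection (R Q : X →L[ℂ] X) : Prop where
  isIdempotentElem : IsIdempotentElem Q
  commute_of_commute : ∀ C, Commute C R → Commute C Q
  finite_ker : FiniteDimensional ℂ Q.ker

namespace IsFiniteCodimProjection

theorem commute {R Q : X →L[ℂ] X} (hQ : IsFiniteCodimProjection R Q) : Commute R Q :=
  hQ.commute_of_commute R (Commute.refl R)

protected theorem one (R : X →L[ℂ] X) : IsFiniteCodimProjection R 1 where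
  isIdempotentElem := IsIdempotentElem.one
  commute_of_commute C _ := Commute.one_right C
  finite_ker := by
    rw [show (1 : X →L[ℂ] X).ker = ⊥ from LinearMap.ker_id]
    infer_instance

protected theorem mul {R P Q : X →L[ℂ] X} (hP : IsFiniteCodimProjection R P)
    (hQ : IsFiniteCodimProjection R Q) : IsFiniteCodimProjection R (P * Q) where
  isIdempotentElem := hP.isIdempotentElem.mul_of_commute
    (hQ.commute_of_commute P hP.commute.symm) hQ.isIdempotentElem
  commute_of_commute C hC := (hP.commute_of_commute C hC).mul_right (hQ.commute_of_commute C hC)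
  finite_ker := by
    have := hP.finite_ker
    have := hQ.finite_ker
    have hmap : (P * Q).ker.map Q.toLinearMap ≤ P.ker := Submodule.map_le_iff_le_comap.2 le_rfl
    exact Module.Finite.iff_fg.2 <| Submodule.fg_of_fg_map_of_fg_inf_ker Q.toLinearMap
      (Module.Finite.iff_fg.1 (Submodule.finiteDimensional_of_le hmap))
      (Module.Finite.iff_fg.1 (Submodule.finiteDimensional_of_le inf_le_right))

end IsFiniteCodimProjection

theorem isFredholm_pow {𝕜 E : Type*} [NontriviallyNormedField 𝕜] [CompleteSpace 𝕜]
    [NormedAddCommGroup E] [NormedSpace 𝕜 E] {A : E →L[𝕜] E} (hA : A.IsFredholm) (n : ℕ) :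
    (A ^ n).IsFredholm := by
  rw [ContinuousLinearMap.isFredholm_iff_exists_isQuasiInverse] at hA ⊢
  obtain ⟨B, hB⟩ := hA
  refine ⟨B ^ n, ?_⟩
  induction n with
  | zero => exact (LinearEquiv.refl 𝕜 E).isQuasiInverse
  | succ n ih =>
    rw [pow_succ A, pow_succ' B]
    exact hB.comp ih

variable [CompleteSpace X]

theorem exists_isFiniteCodimProjection_of_isCompl {B : X →L[ℂ] X} (hB : B.IsFredholm)
    (h : IsCompl B.range B.ker) :
    ∃ Q, IsFiniteCodimProjection B Q ∧ IsUnit (B * Q + (1 - Q)) := by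
  have htop := Submodule.IsCompl.isTopCompl_of_isClosed h hB.isClosed_range B.isClosed_ker
  obtain ⟨Q, hQ, hQrange, hQker⟩ : ∃ Q : X →L[ℂ] X,
      IsIdempotentElem Q ∧ Q.range = B.range ∧ Q.ker = B.ker :=
    ⟨_, Submodule.isIdempotentElem_projectionL htop, Submodule.range_projectionL htop,
      Submodule.ker_projectionL htop⟩
  have hQQ (x : X) : Q (Q x) = Q x := DFunLike.congr_fun hQ.eq x
  have hQB (x : X) : Q (B x) = B x := by
    obtain ⟨y, hy⟩ := hQrange.ge ⟨x, rfl⟩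
    exact hy ▸ hQQ y
  have hBQ (x : X) : B (Q x) = B x := by
    have hmem : x - Q x ∈ B.ker := hQker.le (by simp [hQQ])
    rw [LinearMap.mem_ker, map_sub, sub_eq_zero] at hmem
    exact hmem.symm
  refine ⟨Q, ⟨hQ, fun C hC => ?_, hQker ▸ hB.finite_ker⟩,
    ContinuousLinearMap.isUnit_iff_bijective.2 ⟨(injective_iff_map_eq_zero _).2 fun x hx => ?_,
      fun y => ?_⟩⟩
  · have hCB (x : X) : C (B x) = B (C x) := DFunLike.congr_fun hC.eq x
    refine ((ContinuousLinearMap.IsIdempotentElem.commute_iff hQ).2 ⟨?_, ?_⟩).symm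
    · rw [hQrange]
      rintro _ ⟨x, rfl⟩
      exact ⟨C x, (hCB x).symm⟩
    · rw [hQker]
      intro x (hx : B x = 0)
      exact (hCB x).symm.trans (by rw [hx, map_zero])
  · replace hx : B (Q x) + (x - Q x) = 0 := hx
    have hBx : B x = 0 := by simpa [hBQ, hQB, hQQ] using congrArg Q hx
    have hQx : Q x = 0 := hQker.ge hBx
    simpa [hQx] using hx
  · obtain ⟨w, hw : B w = Q y⟩ := hQrange.le ⟨y, rfl⟩
    refine ⟨Q w + (y - Q y), ?_⟩
    change B (Q (Q w + (y - Q y))) + (Q w + (y - Q y) - Q (Q w + (y - Q y))) = y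
    simp only [map_add, map_sub, hQQ, hBQ, hw, sub_self, add_zero]
    abel

theorem IsBrowder.exists_isFiniteCodimProjection {A : X →L[ℂ] X} (hA : IsBrowder A) :
    ∃ Q, IsFiniteCodimProjection A Q ∧ IsUnit (A * Q + (1 - Q)) := by
  have hker := hA.finite_ascent
  have hrange := hA.finite_descent
  simp only [ContinuousLinearMap.toLinearMap_pow] at hker hrange
  obtain ⟨p, hp, hcompl⟩ := exists_isCompl_range_pow_ker_pow hker hrange
  rw [← ContinuousLinearMap.toLinearMap_pow] at hcompl
  obtain ⟨Q, hQ, hunit⟩ :=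
    exists_isFiniteCodimProjection_of_isCompl (isFredholm_pow hA.isFredholm p) hcompl
  have hQA (C : X →L[ℂ] X) (hC : Commute C A) : Commute C Q :=
    hQ.commute_of_commute C (hC.pow_right p)
  refine ⟨Q, ⟨hQ.isIdempotentElem, hQA, hQ.finite_ker⟩, ?_⟩
  rwa [← mul_add_one_sub_pow hQ.isIdempotentElem (hQA A (Commute.refl A)), isUnit_pow_iff hp]
    at hunit
theorem IsRiesz.exists_nhds_inter_spectrum_mul_subset {R : X →L[ℂ] X} (hR : IsRiesz R) {z : ℂ}
    (hz : z ≠ 0) :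
    ∃ U ∈ 𝓝 z, ∃ Q, IsFiniteCodimProjection R Q ∧ U ∩ spectrum ℂ (R * Q) ⊆ {0} := by
  have hbrowder : IsBrowder (R - z • (1 : X →L[ℂ] X)) := by
    by_contra h
    exact hz (hR h)
  obtain ⟨Q, hQ, hunit⟩ := hbrowder.exists_isFiniteCodimProjection
  have hRQ : IsFiniteCodimProjection R Q :=
    ⟨hQ.isIdempotentElem, fun C hC => hQ.commute_of_commute C
      (hC.sub_right ((Commute.one_right C).smul_right z)), hQ.finite_ker⟩
  have hcont : Continuous fun w : ℂ => (R - w • (1 : X →L[ℂ] X)) * Q + (1 - Q) := by fun_prop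
  refine ⟨_, hcont.continuousAt.preimage_mem_nhds (Units.isOpen.mem_nhds hunit), Q, hRQ, ?_⟩
  rintro w ⟨hw, hmem⟩
  by_contra hw0
  exact notMem_spectrum_mul_of_isUnit hQ.isIdempotentElem hRQ.commute hw0 hw hmem

theorem IsRiesz.exists_inter_spectrum_mul_subset {R : X →L[ℂ] X} (hR : IsRiesz R) {K : Set ℂ}
    (hK : IsCompact K) (hK0 : 0 ∉ K) :
    ∃ Q, IsFiniteCodimProjection R Q ∧ K ∩ spectrum ℂ (R * Q) ⊆ {0} := by
  refine hK.induction_on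
    (p := fun s => ∃ Q, IsFiniteCodimProjection R Q ∧ s ∩ spectrum ℂ (R * Q) ⊆ {0})
    ⟨1, .one R, by simp⟩ (fun s t hst ⟨Q, hQ, ht⟩ =>
      ⟨Q, hQ, (inter_subset_inter_left _ hst).trans ht⟩) ?_ fun z hz => ?_
  · rintro s t ⟨P, hP, hs⟩ ⟨Q, hQ, ht⟩
    have hPQ : Commute P Q := hQ.commute_of_commute P hP.commute.symm
    have hsubP : spectrum ℂ (R * (P * Q)) ⊆ insert 0 (spectrum ℂ (R * P)) := by
      rw [← mul_assoc]
      exact spectrum_mul_subset_insert_zero hQ.isIdempotentElem (hQ.commute.mul_left hPQ)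
    have hsubQ : spectrum ℂ (R * (P * Q)) ⊆ insert 0 (spectrum ℂ (R * Q)) := by
      rw [hPQ.eq, ← mul_assoc]
      exact spectrum_mul_subset_insert_zero hP.isIdempotentElem (hP.commute.mul_left hPQ.symm)
    refine ⟨P * Q, hP.mul hQ, ?_⟩
    rintro z ⟨hz | hz, hmem⟩
    · exact (hsubP hmem).elim id fun h => hs ⟨hz, h⟩
    · exact (hsubQ hmem).elim id fun h => ht ⟨hz, h⟩
  · obtain ⟨U, hU, hQ⟩ :=
      hR.exists_nhds_inter_spectrum_mul_subset (ne_of_mem_of_not_mem hz hK0)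
    exact ⟨U, mem_nhdsWithin_of_mem_nhds hU, hQ⟩

theorem IsRiesz.exists_spectralRadius_mul_le {R : X →L[ℂ] X} (hR : IsRiesz R) {ε : ENNReal}
    (hε : ε ≠ 0) : ∃ Q, IsFiniteCodimProjection R Q ∧ spectralRadius ℂ (R * Q) ≤ ε := by
  have hclosed : IsClosed {z : ℂ | ε ≤ ‖z‖ₑ} := isClosed_le continuous_const continuous_enorm
  obtain ⟨Q, hQ, hsub⟩ := hR.exists_inter_spectrum_mul_subset
    ((spectrum.isCompact (𝕜 := ℂ) R).inter_right hclosed) fun h => hε (by simpa using h.2)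
  refine ⟨Q, hQ, iSup₂_le fun z hz => ?_⟩
  obtain rfl | hzR := spectrum_mul_subset_insert_zero hQ.isIdempotentElem hQ.commute hz
  · simp
  · by_contra! hlt
    obtain rfl : z = 0 := hsub ⟨⟨hzR, hlt.le⟩, hz⟩
    simp at hlt

theorem finite_spectrum_diff {S S' Q : X →L[ℂ] X} (hQ : IsIdempotentElem Q) (hSQ : Commute S Q)
    (hS'Q : Commute S' Q) [FiniteDimensional ℂ Q.ker] (h : S * Q = S' * Q) :
    (spectrum ℂ S \ spectrum ℂ S').Finite := by
  have hS := Reduces.of_commute hQ hSQ.symm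
  have hS' := Reduces.of_commute hQ hS'Q.symm
  have hfin : (spectrum ℂ (S.restrict hS.invariant_left : Q.ker →L[ℂ] Q.ker)).Finite := by
    have := hS.isClosed_left.completeSpace_coe
    rw [ContinuousLinearMap.spectrum_eq]
    exact Module.End.finite_spectrum _
  have hrange : (S.restrict hS.invariant_right : Q.range →L[ℂ] Q.range) =
      S'.restrict hS'.invariant_right := by
    ext ⟨_, x, rfl⟩
    exact DFunLike.congr_fun h x
  refine hfin.subset ?_
  rw [hS.spectrum_eq, hS'.spectrum_eq, hrange]
  exact fun z hz => hz.1.resolve_right fun hr => hz.2 (.inr hr)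

theorem countable_spectrum_diff {S T : X →L[ℂ] X} {Q : ℕ → X →L[ℂ] X} (hST : Commute S T)
    (hQ : ∀ n, IsIdempotentElem (Q n)) (hSQ : ∀ n, Commute S (Q n)) (hTQ : ∀ n, Commute T (Q n))
    (hker : ∀ n, FiniteDimensional ℂ (Q n).ker)
    (hlim : Tendsto (fun n => spectralRadius ℂ ((S - T) * Q n)) atTop (𝓝 0)) :
    (spectrum ℂ S \ spectrum ℂ T).Countable := by
  -- `V n` differs from `S` only on the finite-dimensional `(Q n).ker`, and from `T` by an operator
  -- of small spectral radius.
  let V (n : ℕ) : X →L[ℂ] X := T + (S - T) * Q n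
  have hVQ (n : ℕ) : Commute (V n) (Q n) :=
    (hTQ n).add_left (((hSQ n).sub_left (hTQ n)).mul_left (Commute.refl _))
  have hSV (n : ℕ) : S * Q n = V n * Q n := by
    rw [add_mul, mul_assoc, (hQ n).eq, sub_mul, add_sub_cancel]
  refine (countable_iUnion fun n =>
    (finite_spectrum_diff (hQ n) (hSQ n) (hVQ n) (hSV n)).countable).mono ?_
  rintro z ⟨hzS, hzT⟩
  obtain ⟨u, hu⟩ := IsUnit.sub_iff.1 (spectrum.notMem_iff.1 hzT)
  have hlim_mul : Tendsto (fun n => spectralRadius ℂ (↑u⁻¹ : X →L[ℂ] X) *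
      spectralRadius ℂ ((S - T) * Q n)) atTop (𝓝 0) := by
    simpa using ENNReal.Tendsto.const_mul hlim (.inr (spectralRadius_lt_top _).ne)
  obtain ⟨n, hn⟩ := (hlim_mul.eventually_lt_const zero_lt_one).exists
  have hcomm : Commute (u : X →L[ℂ] X) ((S - T) * Q n) := by
    rw [hu]
    exact ((hST.symm.sub_right (Commute.refl T)).mul_right (hTQ n)).sub_left
      (Algebra.commute_algebraMap_left z _)
  have hunit := isUnit_add_of_spectralRadius_inv_mul_lt_one hcomm hn
  rw [hu, sub_add_eq_add_sub] at hunit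
  exact mem_iUnion.2 ⟨n, hzS, spectrum.notMem_iff.2 (IsUnit.sub_iff.1 hunit)⟩

theorem IsRiesz.countable_spectrum_add_symmDiff {T R : X →L[ℂ] X} (hR : IsRiesz R)
    (hTR : Commute T R) : (symmDiff (spectrum ℂ (T + R)) (spectrum ℂ T)).Countable := by
  have hexists (n : ℕ) :=
    hR.exists_spectralRadius_mul_le (ENNReal.inv_ne_zero.2 (ENNReal.natCast_ne_top n))
  choose Q hQ hle using hexists
  have hlim : Tendsto (fun n => spectralRadius ℂ (R * Q n)) atTop (𝓝 0) :=
    tendsto_of_tendsto_of_tendsto_of_le_of_le tendsto_const_nhds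
      ENNReal.tendsto_inv_nat_nhds_zero (fun _ => bot_le) hle
  have hidem (n : ℕ) := (hQ n).isIdempotentElem
  have hker (n : ℕ) := (hQ n).finite_ker
  have hT (n : ℕ) : Commute T (Q n) := (hQ n).commute_of_commute T hTR
  have hadd (n : ℕ) : Commute (T + R) (Q n) := (hT n).add_left (hQ n).commute
  have hcomm : Commute (T + R) T := (Commute.refl T).add_left hTR.symm
  refine .union (countable_spectrum_diff hcomm hidem hadd hT hker ?_)
    (countable_spectrum_diff hcomm.symm hidem hT hadd hker ?_)
  · simpa only [add_sub_cancel_left] using hlim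
  · simpa only [sub_add_cancel_left, neg_mul, spectralRadius_neg] using hlim

theorem isAlmostInvertible_congr {S T : X →L[ℂ] X}
    (h : (symmDiff (spectrum ℂ S) (spectrum ℂ T)).Countable) :
    IsAlmostInvertible S ↔ IsAlmostInvertible T := by
  rw [isAlmostInvertible_iff, isAlmostInvertible_iff]
  have hmost : ∀ᶠ z in cocountable, z ∉ symmDiff (spectrum ℂ S) (spectrum ℂ T) :=
    mem_cocountable.2 (by rwa [← compl_def, compl_compl])
  refine eventually_congr ?_
  filter_upwards [hmost.filter_mono inf_le_right] with z hz
  rw [mem_symmDiff] at hz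
  tauto

theorem almostSpectrum_add_of_isRiesz {T R : X →L[ℂ] X} (hTR : Commute T R) (hR : IsRiesz R) :
    almostSpectrum (T + R) = almostSpectrum T := by
  ext z
  have hcomm : Commute (T - z • (1 : X →L[ℂ] X)) R :=
    hTR.sub_left ((Commute.one_left R).smul_left z)
  refine not_congr ?_
  rw [← sub_add_eq_add_sub]
  exact isAlmostInvertible_congr (hR.countable_spectrum_add_symmDiff hcomm)

end Riesz

end AlmostInv

theorem mainTheorem8 {X : Type*} [NormedAddCommGroup X] [NormedSpace ℂ X] [CompleteSpace X]
    (T : X →L[ℂ] X) :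
    (AlmostInv.IsAlmostInvertible T ↔ AlmostInv.IsAlmostInvertible (AlmostInv.dualOp T)) ∧
    (∀ (Y : Type*) [NormedAddCommGroup Y] [NormedSpace ℂ Y] [CompleteSpace Y] (S : Y →L[ℂ] Y),
      AlmostInv.IsAlmostInvertible (T.prodMap S) ↔
        AlmostInv.IsAlmostInvertible T ∧ AlmostInv.IsAlmostInvertible S) ∧
    ((AlmostInv.IsAlmostInvertible T ↔
        ∃ m : ℕ, 1 ≤ m ∧ AlmostInv.IsAlmostInvertible (T ^ m)) ∧
      (AlmostInv.IsAlmostInvertible T ↔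
        ∀ m : ℕ, 1 ≤ m → AlmostInv.IsAlmostInvertible (T ^ m))) ∧
    (∀ (M : Submodule ℂ X) [IsClosed (M : Set X)] (hM : ∀ x ∈ M, T x ∈ M),
      AlmostInv.IsAlmostInvertible (T.restrict hM : M →L[ℂ] M) →
      AlmostInv.IsAlmostInvertible (AlmostInv.quotientOp T M hM) →
      AlmostInv.IsAlmostInvertible T) ∧
    (∀ R : X →L[ℂ] X, Commute T R → AlmostInv.IsRiesz R →
      AlmostInv.almostSpectrum (T + R) = AlmostInv.almostSpectrum T) := by
  refine ⟨AlmostInv.isAlmostInvertible_dualOp_iff.symm,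
    fun Y _ _ _ S => AlmostInv.isAlmostInvertible_prodMap_iff,
    ⟨⟨fun h => ⟨1, le_rfl, by rwa [pow_one]⟩, fun ⟨m, hm, h⟩ => ?_⟩,
      ⟨fun h m hm => ?_, fun h => ?_⟩⟩,
    fun M _ hM => AlmostInv.isAlmostInvertible_of_restrict_of_quotientOp,
    fun R => AlmostInv.almostSpectrum_add_of_isRiesz⟩
  · exact (AlmostInv.isAlmostInvertible_pow_iff hm).1 h
  · exact (AlmostInv.isAlmostInvertible_pow_iff hm).2 h
  · exact (AlmostInv.isAlmostInvertible_pow_iff le_rfl).1 (h 1 le_rfl)
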